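/- Let $\mathcal C$ be a small category with finite products, and let $P, Q : \mathcal C \to \mathbf{Set}$ be functors that preserve finite products. Define a functor $P+Q : \mathcal C \to \mathbf{Set}$ by the coend \[ (P+Q)(c) \;=\; \int^{(c_1,c_2)\in\mathcal C\times\mathcal C} \mathrm{Hom}_{\mathcal C}(c_1\times c_2,\,c)\times P(c_1)\times Q(c_2), \] where the integrand is contravariant in the occurrence of $(c_1,c_2)$ in $\mathrm{Hom}_{\mathcal C}(c_1\times c_2, c)$ and covariant in its occurrence in $P(c_1)\times Q(c_2)$, and where a morphism $c\to c'$ acts by postcomposition on the Hom-set. Write $[c_1,c_2,f,x,y]$ for the class in $(P+Q)(c)$ of $f : c_1\times c_2\to c$, $x\in P(c_1)$, $y\in Q(c_2)$. Then $P+Q$ preserves finite products, and it is the coproduct of $P$ and $Q$ in the category of finite-product-preserving functors $\mathcal C\to\mathbf{Set}$ and natural transformations. The coproduct injections $P\to P+Q$ and $Q\to P+Q$ are $x\mapsto [c,1,\pi_1,x,*]$ for $x \in P(c)$ and $y\mapsto[1,c,\pi_2,*,y]$ for $y \in Q(c)$, where $1$ is the terminal object of $\mathcal C$ and $*$ denotes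 the unique element of $Q(1)$, respectively of $P(1)$. -/

import Mathlib

open CategoryTheory CategoryTheory.Limits Opposite

universe w v u

noncomputable section

namespace ProductPreserving

variable {C : Type u} [Category.{v} C]

/-- The property of a functor `C ⥤ Type _` of preserving finite products. -/
abbrev isProductPreserving (C : Type u) [Category.{v} C] :
    ObjectProperty (C ⥤ Type (max w u v)) :=
  fun F => PreservesFiniteProducts F

/-- The category of finite-product-preserving functors `C ⥤ Type _`
and all natural transformations between them. -/
abbrev ProdPresheaf (C : Type u) [Category.{v} C] :=
  (isProductPreserving.{w} C).FullSubcategory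

variable [HasFiniteProducts C]

/-- The integrand `((c₁, c₂), (d₁, d₂)) ↦ Hom(c₁ × c₂, c) × P(d₁) × Q(d₂)`, contravariant
in `(c₁, c₂)` and covariant in `(d₁, d₂)`. -/
def integrand (P Q : C ⥤ Type (max w u v)) (c : C) :
    (C × C)ᵒᵖ ⥤ (C × C) ⥤ Type (max w u v) where
  obj a :=
    { obj := fun d => (a.unop.1 ⨯ a.unop.2 ⟶ c) × P.obj d.1 × Q.obj d.2
      map := fun g => TypeCat.ofHom fun t => (t.1, P.map g.1 t.2.1, Q.map g.2 t.2.2) }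
  map g :=
    { app := fun _ => TypeCat.ofHom fun t => (prod.map g.unop.1 g.unop.2 ≫ t.1, t.2) }

/-- The integrand is covariant in `c`, by postcomposition. -/
def integrandMap (P Q : C ⥤ Type (max w u v)) {c c' : C} (k : c ⟶ c') :
    integrand P Q c ⟶ integrand P Q c' where
  app _ := { app := fun _ => TypeCat.ofHom fun t => (t.1 ≫ k, t.2) }
  naturality _ _ _ := by
    ext d t
    exact Prod.ext (Category.assoc _ _ _) rfl

/-- The functor `c ↦ ∫^{c₁, c₂} Hom(c₁ × c₂, c) × P(c₁) × Q(c₂)`. -/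
def coendFunctor (P Q : C ⥤ Type (max w u v)) : C ⥤ Type (max w u v) where
  obj c := coend (integrand P Q c)
  map k := coend.map (integrandMap P Q k)
  map_id c := by
    have h : integrandMap P Q (𝟙 c) = 𝟙 _ := by
      ext a d t
      exact Prod.ext (Category.comp_id _) rfl
    rw [h, coend.map_id]
  map_comp k l := by
    have h : integrandMap P Q (k ≫ l) = integrandMap P Q k ≫ integrandMap P Q l := by
      ext a d t
      exact Prod.ext (Category.assoc _ _ _).symm rfl
    rw [h, coend.map_comp]

/-- The class in the coend of the tuple `(c₁, c₂, f, x, y)`. -/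
def coendMk {P Q : C ⥤ Type (max w u v)} {c : C} (c₁ c₂ : C) (f : c₁ ⨯ c₂ ⟶ c)
    (x : P.obj c₁) (y : Q.obj c₂) : (coendFunctor P Q).obj c :=
  coend.ι (integrand P Q c) (c₁, c₂) (f, x, y)

end ProductPreserving

end

/-! A product-preserving `F` identifies `F(a × b)` with `F(a) × F(b)`, so elements can be paired. A
pair of classes `[f, x, y]` over `a` and `[g, x', y']` over `b` then gives `coendPairMk`, a class
over `a × b` indexed by `(c₁ × d₁, c₂ × d₂)`. This inverts the comparison map: dinaturality along
projections gives one composite, along diagonals the other.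

For the universal property, `[c₁, c₂, f, x, y]` is the image under `f` of `[c₁, c₂, 𝟙, x, y]`, whose
projections are the injections of `x` and `y`. A map to a product-preserving `R` is therefore forced
to send it to `R(f)(α(x), β(y))`, and this formula is dinatural. -/

noncomputable section

namespace ProductPreserving

variable {C : Type u} [Category.{v} C] [HasFiniteProducts C]

/-! ### Pairing elements of product-preserving functors -/

section Pairing

variable (F : C ⥤ Type (max w u v))

/-- The map `F(a × b) → F(a) × F(b)` induced by the projections. -/
def prodSplit (a b : C) (z : F.obj (a ⨯ b)) : F.obj a × F.obj b :=
  (F.map prod.fst z, F.map prod.snd z)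

theorem prodSplit_bijective [PreservesFiniteProducts F] (a b : C) :
    Function.Bijective (prodSplit.{w} F a b) := by
  let e := (isLimitOfHasBinaryProductOfPreservesLimit F a b).conePointUniqueUpToIso
    (Types.binaryProductLimit (F.obj a) (F.obj b))
  have h : ⇑(ConcreteCategory.hom e.hom) = prodSplit.{w} F a b := rfl
  rw [← h]
  exact (isIso_iff_bijective _).1 inferInstance

theorem preservesLimit_pair_of_bijective (a b : C)
    (h : Function.Bijective (prodSplit.{w} F a b)) : PreservesLimit (pair a b) F := by
  refine preservesLimit_of_preserves_limit_cone (prodIsProd a b)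
    ((isLimitMapConeBinaryFanEquiv F _ _).symm ?_)
  let e : F.obj (a ⨯ b) ≅ F.obj a × F.obj b := (Equiv.ofBijective _ h).toIso
  exact IsLimit.ofIsoLimit (Types.binaryProductLimit (F.obj a) (F.obj b))
    (BinaryFan.ext e rfl rfl).symm

variable {F} [PreservesFiniteProducts F] {a b : C}

/-- The element of `F(a × b)` with the given components. -/
def pairing (x : F.obj a) (y : F.obj b) : F.obj (a ⨯ b) :=
  (Equiv.ofBijective _ (prodSplit_bijective.{w} F a b)).symm (x, y)

theorem prodSplit_pairing (x : F.obj a) (y : F.obj b) :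
    prodSplit.{w} F a b (pairing.{w} x y) = (x, y) :=
  (Equiv.ofBijective _ (prodSplit_bijective.{w} F a b)).apply_symm_apply (x, y)

theorem map_fst_pairing (x : F.obj a) (y : F.obj b) :
    F.map prod.fst (pairing.{w} x y) = x :=
  congrArg Prod.fst (prodSplit_pairing.{w} x y)

theorem map_snd_pairing (x : F.obj a) (y : F.obj b) :
    F.map prod.snd (pairing.{w} x y) = y :=
  congrArg Prod.snd (prodSplit_pairing.{w} x y)

theorem prod_obj_ext {z z' : F.obj (a ⨯ b)} (h₁ : F.map prod.fst z = F.map prod.fst z')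
    (h₂ : F.map prod.snd z = F.map prod.snd z') : z = z' :=
  (prodSplit_bijective.{w} F a b).1 (Prod.ext h₁ h₂)

theorem map_prodMap_pairing {a' b' : C} (f : a ⟶ a') (g : b ⟶ b') (x : F.obj a)
    (y : F.obj b) :
    F.map (prod.map f g) (pairing.{w} x y) = pairing.{w} (F.map f x) (F.map g y) := by
  apply prod_obj_ext.{w}
  · rw [map_fst_pairing, ← Functor.map_comp_apply, prod.map_fst, Functor.map_comp_apply,
      map_fst_pairing]
  · rw [map_snd_pairing, ← Functor.map_comp_apply, prod.map_snd, Functor.map_comp_apply,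
      map_snd_pairing]

theorem map_lift_id_id_eq_pairing (x : F.obj a) :
    F.map (prod.lift (𝟙 a) (𝟙 a)) x = pairing.{w} x x := by
  apply prod_obj_ext.{w}
  · rw [map_fst_pairing, ← Functor.map_comp_apply, prod.lift_fst, Functor.map_id_apply]
  · rw [map_snd_pairing, ← Functor.map_comp_apply, prod.lift_snd, Functor.map_id_apply]

variable (F) in
/-- A product-preserving functor takes a singleton as its value at the terminal object. -/
abbrev uniqueObjTerminal : Unique (F.obj (⊤_ C)) :=
  Types.isTerminalEquivUnique _ (isLimitOfHasTerminalOfPreservesLimit F)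

end Pairing

/-! ### The coend: generators, injections and universal property -/

section Coend

variable {P Q : C ⥤ Type (max w u v)}

theorem coendMk_prodMap_comp {c c₁ c₂ d₁ d₂ : C} (g₁ : c₁ ⟶ d₁) (g₂ : c₂ ⟶ d₂)
    (f : d₁ ⨯ d₂ ⟶ c) (x : P.obj c₁) (y : Q.obj c₂) :
    coendMk.{w} c₁ c₂ (prod.map g₁ g₂ ≫ f) x y =
      coendMk.{w} d₁ d₂ f (P.map g₁ x) (Q.map g₂ y) := by
  let t : (d₁ ⨯ d₂ ⟶ c) × P.obj c₁ × Q.obj c₂ := (f, x, y)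
  exact ConcreteCategory.congr_hom
    (coend.condition (integrand.{w} P Q c) (i := (c₁, c₂)) (j := (d₁, d₂)) (g₁, g₂)) t

theorem map_coendMk {c c' c₁ c₂ : C} (k : c ⟶ c') (f : c₁ ⨯ c₂ ⟶ c)
    (x : P.obj c₁) (y : Q.obj c₂) :
    (coendFunctor.{w} P Q).map k (coendMk.{w} c₁ c₂ f x y) = coendMk.{w} c₁ c₂ (f ≫ k) x y := by
  let t : (c₁ ⨯ c₂ ⟶ c) × P.obj c₁ × Q.obj c₂ := (f, x, y)
  exact ConcreteCategory.congr_hom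
    (coend.ι_map (integrandMap.{w} P Q k) (c₁, c₂)) t

/-- The map out of the coend given by a dinatural family of maps. -/
def coendLift {c : C} {X : Type (max w u v)}
    (φ : ∀ c₁ c₂ : C, (c₁ ⨯ c₂ ⟶ c) → P.obj c₁ → Q.obj c₂ → X)
    (hφ : ∀ ⦃c₁ c₂ d₁ d₂ : C⦄ (g₁ : c₁ ⟶ d₁) (g₂ : c₂ ⟶ d₂) (f : d₁ ⨯ d₂ ⟶ c)
      (x : P.obj c₁) (y : Q.obj c₂),
      φ c₁ c₂ (prod.map g₁ g₂ ≫ f) x y = φ d₁ d₂ f (P.map g₁ x) (Q.map g₂ y)) :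
    (coendFunctor.{w} P Q).obj c ⟶ X :=
  coend.desc (F := integrand.{w} P Q c)
    (fun j => TypeCat.ofHom fun t => φ j.1 j.2 t.1 t.2.1 t.2.2)
    (fun _ _ g => ConcreteCategory.hom_ext _ _ fun t => hφ g.1 g.2 t.1 t.2.1 t.2.2)

theorem coendLift_coendMk {c : C} {X : Type (max w u v)}
    (φ : ∀ c₁ c₂ : C, (c₁ ⨯ c₂ ⟶ c) → P.obj c₁ → Q.obj c₂ → X)
    (hφ : ∀ ⦃c₁ c₂ d₁ d₂ : C⦄ (g₁ : c₁ ⟶ d₁) (g₂ : c₂ ⟶ d₂) (f : d₁ ⨯ d₂ ⟶ c)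
      (x : P.obj c₁) (y : Q.obj c₂),
      φ c₁ c₂ (prod.map g₁ g₂ ≫ f) x y = φ d₁ d₂ f (P.map g₁ x) (Q.map g₂ y))
    {c₁ c₂ : C} (f : c₁ ⨯ c₂ ⟶ c) (x : P.obj c₁) (y : Q.obj c₂) :
    coendLift.{w} φ hφ (coendMk.{w} c₁ c₂ f x y) = φ c₁ c₂ f x y := by
  let t : (c₁ ⨯ c₂ ⟶ c) × P.obj c₁ × Q.obj c₂ := (f, x, y)
  exact ConcreteCategory.congr_hom
    (coend.ι_desc (F := integrand.{w} P Q c) _ _ (c₁, c₂)) t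

/-- The predicates `p` and `True`, seen as maps to a lifted `Prop`, agree on all coend inclusions,
hence are equal. -/
theorem coend_induction {c : C} {p : (coendFunctor.{w} P Q).obj c → Prop}
    (h : ∀ (c₁ c₂ : C) (f : c₁ ⨯ c₂ ⟶ c) (x : P.obj c₁) (y : Q.obj c₂),
      p (coendMk.{w} c₁ c₂ f x y)) (z : (coendFunctor.{w} P Q).obj c) : p z := by
  let φ : coend (integrand.{w} P Q c) ⟶ ULift.{max w u v} Prop :=
    TypeCat.ofHom fun z => ULift.up (p z)
  let ψ : coend (integrand.{w} P Q c) ⟶ ULift.{max w u v} Prop :=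
    TypeCat.ofHom fun _ => ULift.up True
  have e : φ = ψ := by
    refine coend.hom_ext fun j => ?_
    ext (t : (j.1 ⨯ j.2 ⟶ c) × P.obj j.1 × Q.obj j.2)
    exact iff_true_intro (h j.1 j.2 t.1 t.2.1 t.2.2)
  exact of_eq_true (congrArg ULift.down (ConcreteCategory.congr_hom e z))

variable (P Q) in
/-- The first injection `x ↦ [c, 1, π₁, x, *]`. -/
def coendInl [PreservesFiniteProducts Q] : P ⟶ coendFunctor.{w} P Q where
  app c := TypeCat.ofHom fun x =>
    coendMk.{w} c (⊤_ C) prod.fst x (uniqueObjTerminal.{w} Q).default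
  naturality c d k := ConcreteCategory.hom_ext _ _ fun x => by
    have h := coendMk_prodMap_comp.{w} k (𝟙 (⊤_ C)) prod.fst x (uniqueObjTerminal.{w} Q).default
    rw [Functor.map_id_apply, prod.map_fst] at h
    exact h.symm.trans (map_coendMk.{w} _ _ _ _).symm

variable (P Q) in
/-- The second injection `y ↦ [1, c, π₂, *, y]`. -/
def coendInr [PreservesFiniteProducts P] : Q ⟶ coendFunctor.{w} P Q where
  app c := TypeCat.ofHom fun y =>
    coendMk.{w} (⊤_ C) c prod.snd (uniqueObjTerminal.{w} P).default y
  naturality c d k := ConcreteCategory.hom_ext _ _ fun y => by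
    have h := coendMk_prodMap_comp.{w} (𝟙 (⊤_ C)) k prod.snd (uniqueObjTerminal.{w} P).default y
    rw [Functor.map_id_apply, prod.map_snd] at h
    exact h.symm.trans (map_coendMk.{w} _ _ _ _).symm

theorem coendInl_app_apply [PreservesFiniteProducts Q] {c : C} (x : P.obj c) (t : Q.obj (⊤_ C)) :
    (coendInl.{w} P Q).app c x = coendMk.{w} c (⊤_ C) prod.fst x t := by
  rw [(uniqueObjTerminal.{w} Q).uniq t]
  rfl

theorem coendInr_app_apply [PreservesFiniteProducts P] {c : C} (y : Q.obj c) (t : P.obj (⊤_ C)) :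
    (coendInr.{w} P Q).app c y = coendMk.{w} (⊤_ C) c prod.snd t y := by
  rw [(uniqueObjTerminal.{w} P).uniq t]
  rfl

/-- The natural transformation `[c₁, c₂, f, x, y] ↦ R(f)(α(x), β(y))`. -/
def coendDesc {R : C ⥤ Type (max w u v)} [PreservesFiniteProducts R] (α : P ⟶ R)
    (β : Q ⟶ R) : coendFunctor.{w} P Q ⟶ R where
  app c := coendLift.{w} (fun _ _ f x y => R.map f (pairing.{w} (α.app _ x) (β.app _ y)))
    (fun _ _ _ _ g₁ g₂ f x y => by
      rw [Functor.map_comp_apply, map_prodMap_pairing, NatTrans.naturality_apply,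
        NatTrans.naturality_apply])
  naturality c d k := ConcreteCategory.hom_ext _ _ fun z => by
    induction z using coend_induction.{w} with
    | h c₁ c₂ f x y =>
      rw [ConcreteCategory.comp_apply, ConcreteCategory.comp_apply, map_coendMk,
        coendLift_coendMk, coendLift_coendMk, Functor.map_comp_apply]

theorem coendDesc_app_coendMk {R : C ⥤ Type (max w u v)} [PreservesFiniteProducts R]
    (α : P ⟶ R) (β : Q ⟶ R) {c c₁ c₂ : C} (f : c₁ ⨯ c₂ ⟶ c)
    (x : P.obj c₁) (y : Q.obj c₂) :
    (coendDesc.{w} α β).app c (coendMk.{w} c₁ c₂ f x y) =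
      R.map f (pairing.{w} (α.app _ x) (β.app _ y)) :=
  coendLift_coendMk.{w} _ (_) _ _ _

/-- The first projection factors through `c₁ × 1`, so dinaturality along `c₂ ⟶ 1` discards `y`. -/
theorem coendMk_fst [PreservesFiniteProducts Q] {c₁ c₂ : C} (x : P.obj c₁) (y : Q.obj c₂) :
    coendMk.{w} c₁ c₂ prod.fst x y = (coendInl.{w} P Q).app c₁ x := by
  have h := coendMk_prodMap_comp.{w} (𝟙 c₁) (terminal.from c₂) prod.fst x y
  rw [Functor.map_id_apply, prod.map_fst, Category.comp_id] at h
  rw [h, coendInl_app_apply]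

theorem coendMk_snd [PreservesFiniteProducts P] {c₁ c₂ : C} (x : P.obj c₁) (y : Q.obj c₂) :
    coendMk.{w} c₁ c₂ prod.snd x y = (coendInr.{w} P Q).app c₂ y := by
  have h := coendMk_prodMap_comp.{w} (terminal.from c₁) (𝟙 c₂) prod.snd x y
  rw [Functor.map_id_apply, prod.map_snd, Category.comp_id] at h
  rw [h, coendInr_app_apply]

theorem coendInl_coendDesc [PreservesFiniteProducts Q] {R : C ⥤ Type (max w u v)}
    [PreservesFiniteProducts R] (α : P ⟶ R) (β : Q ⟶ R) :
    coendInl.{w} P Q ≫ coendDesc.{w} α β = α := by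
  ext c x
  exact (coendDesc_app_coendMk.{w} _ _ _ _ _).trans (map_fst_pairing.{w} _ _)

theorem coendInr_coendDesc [PreservesFiniteProducts P] {R : C ⥤ Type (max w u v)}
    [PreservesFiniteProducts R] (α : P ⟶ R) (β : Q ⟶ R) :
    coendInr.{w} P Q ≫ coendDesc.{w} α β = β := by
  ext c y
  exact (coendDesc_app_coendMk.{w} _ _ _ _ _).trans (map_snd_pairing.{w} _ _)

/-! ### Preservation of finite products by the coend -/

variable [PreservesFiniteProducts P] [PreservesFiniteProducts Q]

/-- The class in the coend over `a × b` built from representatives of classes over `a`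
and `b`. -/
def coendPairMk {a b c₁ c₂ d₁ d₂ : C} (f : c₁ ⨯ c₂ ⟶ a) (x : P.obj c₁) (y : Q.obj c₂)
    (g : d₁ ⨯ d₂ ⟶ b) (x' : P.obj d₁) (y' : Q.obj d₂) :
    (coendFunctor.{w} P Q).obj (a ⨯ b) :=
  coendMk.{w} (c₁ ⨯ d₁) (c₂ ⨯ d₂)
    (prod.lift (prod.map prod.fst prod.fst ≫ f) (prod.map prod.snd prod.snd ≫ g))
    (pairing.{w} x x') (pairing.{w} y y')

/-- Putting identities on one side gives the dinaturality in each argument that `coendPair` needs to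
descend to classes. -/
theorem coendPairMk_dinatural {a b c₁ c₂ d₁ d₂ c₁' c₂' d₁' d₂' : C}
    (k₁ : c₁ ⟶ c₁') (k₂ : c₂ ⟶ c₂') (l₁ : d₁ ⟶ d₁') (l₂ : d₂ ⟶ d₂')
    (f : c₁' ⨯ c₂' ⟶ a) (x : P.obj c₁) (y : Q.obj c₂)
    (g : d₁' ⨯ d₂' ⟶ b) (x' : P.obj d₁) (y' : Q.obj d₂) :
    coendPairMk.{w} (prod.map k₁ k₂ ≫ f) x y (prod.map l₁ l₂ ≫ g) x' y' =
      coendPairMk.{w} f (P.map k₁ x) (Q.map k₂ y) g (P.map l₁ x') (Q.map l₂ y') := by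
  unfold coendPairMk
  rw [← map_prodMap_pairing, ← map_prodMap_pairing, ← coendMk_prodMap_comp]
  congr 1
  ext <;> simp

/-- The pairing map `(P+Q)(a) × (P+Q)(b) → (P+Q)(a × b)`, curried. -/
def coendPair (a b : C) :
    (coendFunctor.{w} P Q).obj a ⟶
      ((coendFunctor.{w} P Q).obj b → (coendFunctor.{w} P Q).obj (a ⨯ b)) :=
  coendLift.{w}
    (fun _ _ f x y => coendLift.{w} (fun _ _ g x' y' => coendPairMk.{w} f x y g x' y')
      (fun _ _ _ _ l₁ l₂ g x' y' => by
        simpa using coendPairMk_dinatural.{w} (𝟙 _) (𝟙 _) l₁ l₂ f x y g x' y'))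
    (fun _ _ _ _ k₁ k₂ f x y => funext fun z => by
      induction z using coend_induction.{w} with
      | h d₁ d₂ g x' y' =>
        rw [coendLift_coendMk, coendLift_coendMk]
        simpa using coendPairMk_dinatural.{w} k₁ k₂ (𝟙 _) (𝟙 _) f x y g x' y')

theorem coendPair_coendMk {a b c₁ c₂ d₁ d₂ : C} (f : c₁ ⨯ c₂ ⟶ a) (x : P.obj c₁)
    (y : Q.obj c₂) (g : d₁ ⨯ d₂ ⟶ b) (x' : P.obj d₁) (y' : Q.obj d₂) :
    coendPair.{w} a b (coendMk.{w} c₁ c₂ f x y) (coendMk.{w} d₁ d₂ g x' y') =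
      coendPairMk.{w} f x y g x' y' := by
  unfold coendPair
  erw [coendLift_coendMk.{w}]
  exact coendLift_coendMk.{w} _ _ _ _ _

/-- An element paired with itself is its image under the diagonal; dinaturality moves the diagonals
into the Hom-set, where they cancel the projections. -/
theorem coendPairMk_comp_fst_comp_snd {a b c₁ c₂ : C} (f : c₁ ⨯ c₂ ⟶ a ⨯ b)
    (x : P.obj c₁) (y : Q.obj c₂) :
    coendPairMk.{w} (f ≫ prod.fst) x y (f ≫ prod.snd) x y = coendMk.{w} c₁ c₂ f x y := by
  unfold coendPairMk
  rw [← map_lift_id_id_eq_pairing, ← map_lift_id_id_eq_pairing, ← coendMk_prodMap_comp]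
  have h₁ : prod.map (prod.lift (𝟙 c₁) (𝟙 c₁)) (prod.lift (𝟙 c₂) (𝟙 c₂)) ≫
      prod.map prod.fst prod.fst = 𝟙 (c₁ ⨯ c₂) := by
    rw [prod.map_map, prod.lift_fst, prod.lift_fst, prod.map_id_id]
  have h₂ : prod.map (prod.lift (𝟙 c₁) (𝟙 c₁)) (prod.lift (𝟙 c₂) (𝟙 c₂)) ≫
      prod.map prod.snd prod.snd = 𝟙 (c₁ ⨯ c₂) := by
    rw [prod.map_map, prod.lift_snd, prod.lift_snd, prod.map_id_id]
  rw [prod.comp_lift, reassoc_of% h₁, reassoc_of% h₂, ← prod.comp_lift, prod.lift_fst_snd,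
    Category.comp_id]

theorem map_fst_coendPairMk {a b c₁ c₂ d₁ d₂ : C} (f : c₁ ⨯ c₂ ⟶ a) (x : P.obj c₁)
    (y : Q.obj c₂) (g : d₁ ⨯ d₂ ⟶ b) (x' : P.obj d₁) (y' : Q.obj d₂) :
    (coendFunctor.{w} P Q).map prod.fst (coendPairMk.{w} f x y g x' y') =
      coendMk.{w} c₁ c₂ f x y := by
  unfold coendPairMk
  rw [map_coendMk, prod.lift_fst, coendMk_prodMap_comp, map_fst_pairing, map_fst_pairing]

theorem map_snd_coendPairMk {a b c₁ c₂ d₁ d₂ : C} (f : c₁ ⨯ c₂ ⟶ a) (x : P.obj c₁)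
    (y : Q.obj c₂) (g : d₁ ⨯ d₂ ⟶ b) (x' : P.obj d₁) (y' : Q.obj d₂) :
    (coendFunctor.{w} P Q).map prod.snd (coendPairMk.{w} f x y g x' y') =
      coendMk.{w} d₁ d₂ g x' y' := by
  unfold coendPairMk
  rw [map_coendMk, prod.lift_snd, coendMk_prodMap_comp, map_snd_pairing, map_snd_pairing]

theorem prodSplit_coendFunctor_bijective (a b : C) :
    Function.Bijective (prodSplit.{w} (coendFunctor.{w} P Q) a b) := by
  refine Function.bijective_iff_has_inverse.2
    ⟨fun s => coendPair.{w} a b s.1 s.2, fun z => ?_, fun s => ?_⟩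
  · induction z using coend_induction.{w} with
    | h c₁ c₂ f x y =>
      simp only [prodSplit]
      rw [map_coendMk, map_coendMk, coendPair_coendMk, coendPairMk_comp_fst_comp_snd]
  · obtain ⟨s, t⟩ := s
    induction s using coend_induction.{w} with
    | h c₁ c₂ f x y =>
      induction t using coend_induction.{w} with
      | h d₁ d₂ g x' y' =>
        simp only [prodSplit]
        rw [coendPair_coendMk, map_fst_coendPairMk, map_snd_coendPairMk]

variable (P Q) in
/-- The value of the coend functor at the terminal object is a singleton. -/
abbrev uniqueCoendTerminal : Unique ((coendFunctor.{w} P Q).obj (⊤_ C)) where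
  default := coendMk.{w} (⊤_ C) (⊤_ C) (terminal.from _) (uniqueObjTerminal.{w} P).default
    (uniqueObjTerminal.{w} Q).default
  uniq z := by
    induction z using coend_induction.{w} with
    | h c₁ c₂ f x y =>
      -- Any map to `1` factors through `1 × 1`, so dinaturality moves `x` and `y` into the
      -- singletons `P(1)` and `Q(1)`.
      rw [Subsingleton.elim f
        (prod.map (terminal.from c₁) (terminal.from c₂) ≫ terminal.from _), coendMk_prodMap_comp]
      congr 1
      · exact (uniqueObjTerminal.{w} P).uniq _
      · exact (uniqueObjTerminal.{w} Q).uniq _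

variable (P Q) in
theorem preservesFiniteProducts_coendFunctor :
    PreservesFiniteProducts (coendFunctor.{w} P Q) := by
  have : PreservesLimitsOfShape (Discrete WalkingPair) (coendFunctor.{w} P Q) :=
    ⟨fun {K} => by
      have := preservesLimit_pair_of_bijective.{w} _ _ _
        (prodSplit_coendFunctor_bijective.{w} (P := P) (Q := Q) (K.obj ⟨.left⟩) (K.obj ⟨.right⟩))
      exact preservesLimit_of_iso_diagram _ (diagramIsoPair K).symm⟩
  have : PreservesLimit (Functor.empty.{0} C) (coendFunctor.{w} P Q) :=
    preservesTerminal_of_iso _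
      (((Types.isTerminalEquivUnique _).symm (uniqueCoendTerminal.{w} P Q)).uniqueUpToIso
        terminalIsTerminal)
  have := preservesLimitsOfShape_pempty_of_preservesTerminal (coendFunctor.{w} P Q)
  exact .of_preserves_binary_and_terminal _

theorem eq_coendDesc {R : C ⥤ Type (max w u v)} [PreservesFiniteProducts R]
    (m : coendFunctor.{w} P Q ⟶ R) :
    m = coendDesc.{w} (coendInl.{w} P Q ≫ m) (coendInr.{w} P Q ≫ m) := by
  ext c z
  induction z using coend_induction.{w} with
  | h c₁ c₂ f x y =>
    refine Eq.trans ?_ (coendDesc_app_coendMk.{w} _ _ _ _ _).symm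
    change m.app c (coendMk.{w} c₁ c₂ f x y) = _
    -- Naturality reduces to `f = 𝟙`, where both sides lie in `R(c₁ × c₂)` and can be compared by
    -- projections.
    rw [← Category.id_comp f, ← map_coendMk, NatTrans.naturality_apply,
      Category.id_comp]
    congr 1
    apply prod_obj_ext.{w}
    · rw [map_fst_pairing, ← NatTrans.naturality_apply, map_coendMk, Category.id_comp,
        coendMk_fst, NatTrans.comp_app_apply]
    · rw [map_snd_pairing, ← NatTrans.naturality_apply, map_coendMk, Category.id_comp,
        coendMk_snd, NatTrans.comp_app_apply]

end Coend

end ProductPreserving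

end

theorem mainTheorem8 {C : Type u} [Category.{v} C] [HasFiniteProducts C]
    (P Q : ProductPreserving.ProdPresheaf.{w} C) :
    ∃ (h : PreservesFiniteProducts (ProductPreserving.coendFunctor.{w} P.obj Q.obj))
      (inl : P ⟶ (⟨ProductPreserving.coendFunctor.{w} P.obj Q.obj, h⟩ :
        ProductPreserving.ProdPresheaf.{w} C))
      (inr : Q ⟶ (⟨ProductPreserving.coendFunctor.{w} P.obj Q.obj, h⟩ :
        ProductPreserving.ProdPresheaf.{w} C)),
      (∀ (c : C) (x : P.obj.obj c) (t : Q.obj.obj (⊤_ C)),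
        inl.hom.app c x = ProductPreserving.coendMk c (⊤_ C) prod.fst x t) ∧
      (∀ (c : C) (y : Q.obj.obj c) (t : P.obj.obj (⊤_ C)),
        inr.hom.app c y = ProductPreserving.coendMk (⊤_ C) c prod.snd t y) ∧
      Nonempty (IsColimit (BinaryCofan.mk inl inr)) := by
  have := P.property
  have := Q.property
  refine ⟨ProductPreserving.preservesFiniteProducts_coendFunctor.{w} P.obj Q.obj,
    ObjectProperty.homMk (ProductPreserving.coendInl.{w} P.obj Q.obj),
    ObjectProperty.homMk (ProductPreserving.coendInr.{w} P.obj Q.obj),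
    fun _ => ProductPreserving.coendInl_app_apply.{w},
    fun _ => ProductPreserving.coendInr_app_apply.{w}, ⟨?_⟩⟩
  refine BinaryCofan.isColimitMk
    (fun s => have := s.pt.property
      ObjectProperty.homMk (ProductPreserving.coendDesc.{w} s.inl.hom s.inr.hom))
    (fun s => ?_) (fun s => ?_) (fun s m h₁ h₂ => ?_)
  · have := s.pt.property
    exact ObjectProperty.hom_ext _ (ProductPreserving.coendInl_coendDesc.{w} _ _)
  · have := s.pt.property
    exact ObjectProperty.hom_ext _ (ProductPreserving.coendInr_coendDesc.{w} _ _)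
  · have := s.pt.property
    apply ObjectProperty.hom_ext
    rw [← h₁, ← h₂]
    exact ProductPreserving.eq_coendDesc.{w} m.hom
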